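/- Let $K$ be a field. A rooted tree is a finite connected oriented graph in which every vertex has exactly one incoming edge, except the root, which has none; trees are concrete graphs, with vertices in a fixed set $\alpha$, and equality of trees is equality of graphs. The empty graph $\emptyset$ is admitted as a degenerate tree. A subforest $s$ of $t$ is a subgraph of $t$. An admissible cut $c$ of a forest $s$ is a set of edges, together with a set of components that are cut totally (i.e. cut below their root), such that no path from a root to a leaf is cut twice. The pruning $P^c(s)$ is the part of $s$ above the cut and the trunk $R^c(s)$ is the remaining part; $\mathrm{Adm}(s)$ is the set of admissible cuts. If $s$ is a pruning of a tree $t$, every $c\in \mathrm{Adm}(s)$ is also an admissible cut of $t$, and $R^c(t)$ denotes its trunk. If $s$ is a subforest of $t$, $t/s$ is obtained from $t$ by contracting each connected component of $s$ onto a vertex, named by the root of that component. Let $V$ be the vector space with basis the couples $(t,s)$ with $t$ a tree and $s=P^{c_0}(t)$ for some admissible cut $c_0$ of $t$, and $\tilde V$ the vector space with basis the couples $(t,s)$ with $t$ a tree and $s$ a subforest of $t$. Define $\Delta:V\to V\otimes V$ and $\phi:V\to\tilde V\otimes V$ by $$\Delta(t,s)=\sum_{c\in \mathrm{Adm}(s)}(t,P^c(s))\otimes(R^c(t),R^c(s)),\qquad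 \phi(t,s)=\sum_{s'\subseteq s}(t,s')\otimes(t/s',s/s'),$$ where $s'$ runs over the covering subforests of $s$ (same vertices as $s$, some of its edges). Define $\xi:\tilde V\otimes\tilde V\otimes V\to\tilde V\otimes V$ on basis elements by $$\xi\big((t',s')\otimes(t'',s'')\otimes(u,v)\big)=(t',s'\cup s'')\otimes\big(t'/(s'\cup s''),\,P^{\tilde c}(t'/(s'\cup s''))\big)$$ if $t''=R^c(t')$ for some admissible cut $c$ of $t'$, $u=t'/s'$, and $v=P^{\tilde c}(t'/s')$ for some admissible cut $\tilde c$ of $t'$ that contains no edge of $s'$ or $s''$ (so that $\tilde c$ is also an admissible cut of $t'/s'$ and of $t'/(s'\cup s'')$; it is unique), and by $0$ otherwise. Let $\tau^{23}$ exchange the second and third factors of $\tilde V\otimes V\otimes\tilde V\otimes V$. **Theorem.** As maps $V\to\tilde V\otimes V\otimes V$, $$(\mathrm{id}\otimes\Delta)\circ\phi=(\xi\otimes \mathrm{id})\circ\tau^{23}\circ(\phi\otimes\phi)\circ\Delta .$$ -/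

import Mathlib

open scoped TensorProduct

namespace TreeDoubling

/-- A finite oriented graph with vertices labelled in `α`; the edge `(x, y)` goes from `x` to `y`. -/
@[ext]
structure OGraph (α : Type*) where
  verts : Finset α
  edges : Finset (α × α)
  src_mem : ∀ x y, (x, y) ∈ edges → x ∈ verts
  tgt_mem : ∀ x y, (x, y) ∈ edges → y ∈ verts

namespace OGraph

variable {α : Type*}

/-- There is an oriented path (possibly of length zero) from `x` to `y`. -/
def Reach (t : OGraph α) : α → α → Prop :=
  Relation.ReflTransGen (fun x y => (x, y) ∈ t.edges)

/-- Rooted trees: there is a root `r` without incoming edge, every other vertex has exactly one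
incoming edge, and the graph is connected (equivalently, for such graphs, every vertex is
reached from the root). -/
def IsTree (t : OGraph α) : Prop :=
  ∃ r ∈ t.verts, (∀ x, (x, r) ∉ t.edges) ∧
    (∀ y ∈ t.verts, y ≠ r → ∃! x, (x, y) ∈ t.edges) ∧ ∀ y ∈ t.verts, t.Reach r y

/-- A rooted tree, or the empty graph (the unit `𝟏`, which is the trunk of the total cut). -/
def IsTreeOrEmpty (t : OGraph α) : Prop := t.verts = ∅ ∨ t.IsTree

/-- `s` is a subgraph of `t`; the subgraphs of a tree are its subforests. -/
def IsSub (s t : OGraph α) : Prop := s.verts ⊆ t.verts ∧ s.edges ⊆ t.edges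

open Classical in
/-- The union of two graphs. -/
noncomputable def union (s t : OGraph α) : OGraph α where
  verts := s.verts ∪ t.verts
  edges := s.edges ∪ t.edges
  src_mem x y h := by
    rcases Finset.mem_union.1 h with h | h
    · exact Finset.mem_union_left _ (s.src_mem x y h)
    · exact Finset.mem_union_right _ (t.src_mem x y h)
  tgt_mem x y h := by
    rcases Finset.mem_union.1 h with h | h
    · exact Finset.mem_union_left _ (s.tgt_mem x y h)
    · exact Finset.mem_union_right _ (t.tgt_mem x y h)

open Classical in
/-- The subgraph of `t` induced on the vertices that satisfy `p`. -/
noncomputable def induce (t : OGraph α) (p : α → Prop) : OGraph α where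
  verts := t.verts.filter p
  edges := t.edges.filter fun e => p e.1 ∧ p e.2
  src_mem x y h := by
    have h := Finset.mem_filter.1 h
    exact Finset.mem_filter.2 ⟨t.src_mem x y h.1, h.2.1⟩
  tgt_mem x y h := by
    have h := Finset.mem_filter.1 h
    exact Finset.mem_filter.2 ⟨t.tgt_mem x y h.1, h.2.2⟩

/-- Admissible cuts of a forest. An edge is named by its upper endpoint, and a root `x` stands for
the total cut of the component of `x`. The cut is admissible if no path contains two of its
members. -/
def IsAdm (s : OGraph α) (c : Finset α) : Prop :=
  c ⊆ s.verts ∧ ∀ x ∈ c, ∀ y ∈ c, s.Reach x y → x = y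

open Classical in
/-- The set `Adm(s)` of admissible cuts of `s`. -/
noncomputable def adm (s : OGraph α) : Finset (Finset α) := s.verts.powerset.filter s.IsAdm

/-- `y` lies above the cut `c`. -/
def Above (s : OGraph α) (c : Finset α) (y : α) : Prop := ∃ x ∈ c, s.Reach x y

/-- The pruning `P^c(s)`. -/
noncomputable def prune (s : OGraph α) (c : Finset α) : OGraph α := s.induce (s.Above c)

/-- The trunk `R^c(s)`. -/
noncomputable def trunk (s : OGraph α) (c : Finset α) : OGraph α := s.induce fun y => ¬ s.Above c y

/-- The cut `c` meets `s`: some edge of `c` is an edge of `s`. -/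
def Meets (c : Finset α) (s : OGraph α) : Prop := ∃ x ∈ c, ∃ y, (y, x) ∈ s.edges

/-- `s'` is a covering subforest of `s`: it has the same vertices, and some of the edges. -/
def IsCovering (s' s : OGraph α) : Prop := s'.verts = s.verts ∧ s'.edges ⊆ s.edges

/-- The graph with the vertices of `s` and the edges of `s` that lie in `E`. -/
noncomputable def spanning (s : OGraph α) (E : Finset (α × α)) (hE : E ⊆ s.edges) : OGraph α where
  verts := s.verts
  edges := E
  src_mem _ _ h := s.src_mem _ _ (hE h)
  tgt_mem _ _ h := s.tgt_mem _ _ (hE h)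

open Classical in
/-- The finite set of covering subforests of `s`. -/
noncomputable def coverings (s : OGraph α) : Finset (OGraph α) :=
  s.edges.powerset.attach.image fun E => s.spanning E.1 (Finset.mem_powerset.1 E.2)

open Classical in
/-- The contraction `t / s`: each connected component of the forest `s` is contracted onto a
vertex, named by the root of the component (a vertex of `t` outside `s` is left as it is).
The edges are those of `t` that are not in `s`; an edge that leaves a component leaves its
root in `t / s`. -/
noncomputable def contract (t s : OGraph α) : OGraph α where
  verts := t.verts.filter fun x => ∀ y, (y, x) ∉ s.edges
  edges := ((t.verts.filter fun x => ∀ y, (y, x) ∉ s.edges) ×ˢ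
      (t.verts.filter fun x => ∀ y, (y, x) ∉ s.edges)).filter fun e =>
    ∃ x, s.Reach e.1 x ∧ (x, e.2) ∈ t.edges ∧ (x, e.2) ∉ s.edges
  src_mem _ _ h := (Finset.mem_product.1 (Finset.mem_filter.1 h).1).1
  tgt_mem _ _ h := (Finset.mem_product.1 (Finset.mem_filter.1 h).1).2

/-! Facts needed for the maps below to be well defined. -/

lemma mem_induce_verts {t : OGraph α} {p : α → Prop} {x : α} :
    x ∈ (t.induce p).verts ↔ x ∈ t.verts ∧ p x := by
  simp [induce]

lemma mem_induce_edges {t : OGraph α} {p : α → Prop} {x y : α} :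
    (x, y) ∈ (t.induce p).edges ↔ (x, y) ∈ t.edges ∧ p x ∧ p y := by
  simp [induce]

lemma mem_contract_verts {t s : OGraph α} {x : α} :
    x ∈ (t.contract s).verts ↔ x ∈ t.verts ∧ ∀ y, (y, x) ∉ s.edges := by
  simp [contract]

lemma mem_contract_edges {t s : OGraph α} {r y : α} :
    (r, y) ∈ (t.contract s).edges ↔ r ∈ (t.contract s).verts ∧ y ∈ (t.contract s).verts ∧
      ∃ x, s.Reach r x ∧ (x, y) ∈ t.edges ∧ (x, y) ∉ s.edges := by
  simp [contract, and_assoc]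

lemma mem_adm {s : OGraph α} {c : Finset α} : c ∈ s.adm ↔ s.IsAdm c := by
  simp only [adm, Finset.mem_filter, Finset.mem_powerset]
  exact ⟨fun h => h.2, fun h => ⟨h.1, h⟩⟩

lemma mem_coverings {s s' : OGraph α} : s' ∈ s.coverings ↔ s'.IsCovering s := by
  simp only [coverings, Finset.mem_image, Finset.mem_attach, true_and, Subtype.exists,
    Finset.mem_powerset, IsCovering]
  constructor
  · rintro ⟨E, hE, rfl⟩
    exact ⟨rfl, hE⟩
  · rintro ⟨h1, h2⟩
    exact ⟨s'.edges, h2, OGraph.ext h1.symm rfl⟩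

lemma Reach.mono {s t : OGraph α} (h : s.edges ⊆ t.edges) {x y : α} (hxy : s.Reach x y) :
    t.Reach x y := by
  induction hxy with
  | refl => exact .refl
  | tail _ hbc ih => exact ih.tail (h hbc)

lemma Reach.mem_verts {t : OGraph α} {x y : α} (h : t.Reach x y) (hx : x ∈ t.verts) :
    y ∈ t.verts := by
  rcases Relation.ReflTransGen.cases_tail h with h | ⟨z, _, hz⟩
  · exact h ▸ hx
  · exact t.tgt_mem _ _ hz

/-- In a tree, every vertex has at most one incoming edge. -/
lemma IsTreeOrEmpty.in_unique {t : OGraph α} (ht : t.IsTreeOrEmpty) {x x' y : α}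
    (h : (x, y) ∈ t.edges) (h' : (x', y) ∈ t.edges) : x = x' := by
  rcases ht with h0 | ⟨r, _, hr, hu, _⟩
  · have := t.src_mem _ _ h
    simp [h0] at this
  · have hy : y ≠ r := by
      rintro rfl
      exact hr _ h
    exact (hu y (t.tgt_mem _ _ h) hy).unique h h'

lemma IsTreeOrEmpty.acyclic {t : OGraph α} (ht : t.IsTreeOrEmpty) (x : α) :
    ¬ Relation.TransGen (fun x y => (x, y) ∈ t.edges) x x := by
  intro hx
  have hxv : x ∈ t.verts := by
    obtain ⟨z, _, hz⟩ := Relation.TransGen.tail'_iff.1 hx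
    exact t.tgt_mem _ _ hz
  have ht' := ht
  rcases ht with h0 | ⟨r, _, hr, hu, hc⟩
  · simp [h0] at hxv
  · have key : ∀ y, t.Reach r y → ¬ Relation.TransGen (fun x y => (x, y) ∈ t.edges) y y := by
      intro y hy
      induction hy with
      | refl =>
        intro h
        obtain ⟨z, _, hz⟩ := Relation.TransGen.tail'_iff.1 h
        exact hr _ hz
      | tail _ hbc ih =>
        intro h
        obtain ⟨z, hz1, hz⟩ := Relation.TransGen.tail'_iff.1 h
        obtain rfl := ht'.in_unique hz hbc
        exact ih (Relation.TransGen.head' hbc hz1)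
    exact key x (hc x hxv) hx

lemma IsTreeOrEmpty.reach_antisymm {t : OGraph α} (ht : t.IsTreeOrEmpty) {x y : α}
    (h : t.Reach x y) (h' : t.Reach y x) : x = y := by
  rcases Relation.reflTransGen_iff_eq_or_transGen.1 h with h1 | h1
  · exact h1.symm
  · exact absurd (h1.trans_left h') (ht.acyclic x)

/-- Two ancestors of a vertex are comparable. -/
lemma IsTreeOrEmpty.reach_total {t s : OGraph α} (ht : t.IsTreeOrEmpty) (hs : s.IsSub t) {x x' y : α}
    (h : s.Reach x y) (h' : s.Reach x' y) : s.Reach x x' ∨ s.Reach x' x := by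
  induction h with
  | refl => exact Or.inr h'
  | @tail b c hb hbc ih =>
    rcases Relation.ReflTransGen.cases_tail h' with h1 | ⟨z, hz1, hz⟩
    · subst h1
      exact Or.inl (Relation.ReflTransGen.tail hb hbc)
    · obtain rfl := ht.in_unique (hs.2 hz) (hs.2 hbc)
      exact ih hz1

/-- An admissible cut is determined by its pruning. -/
lemma IsTreeOrEmpty.cut_unique {t : OGraph α} (ht : t.IsTreeOrEmpty) {c c' : Finset α}
    (hc : t.IsAdm c) (hc' : t.IsAdm c') (h : t.prune c = t.prune c') : c = c' := by
  have aux : ∀ {c c' : Finset α}, t.IsAdm c → t.prune c = t.prune c' → c ⊆ c' := by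
    intro c c' hc h x hx
    have h1 : x ∈ (t.prune c).verts := mem_induce_verts.2 ⟨hc.1 hx, x, hx, .refl⟩
    rw [h] at h1
    obtain ⟨_, y, hy, hyx⟩ := mem_induce_verts.1 h1
    by_cases hyv : y ∈ t.verts
    · have h2 : y ∈ (t.prune c').verts := mem_induce_verts.2 ⟨hyv, y, hy, .refl⟩
      rw [← h] at h2
      obtain ⟨_, z, hz, hzy⟩ := mem_induce_verts.1 h2
      obtain rfl := hc.2 z hz x hx (Relation.ReflTransGen.trans hzy hyx)
      rwa [ht.reach_antisymm hzy hyx]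
    · rcases Relation.ReflTransGen.cases_head hyx with h3 | ⟨w, hw, _⟩
      · exact h3 ▸ hy
      · exact absurd (t.src_mem _ _ hw) hyv
  exact Finset.Subset.antisymm (aux hc h) (aux hc' h.symm)

/-- The pruning `s` is closed upwards in `t`. -/
lemma reach_induce_of_reach {t : OGraph α} {c : Finset α} {x y : α} (hx : t.Above c x)
    (h : t.Reach x y) : (t.prune c).Reach x y := by
  induction h with
  | refl => exact .refl
  | @tail a b hb hbc ih =>
    obtain ⟨z, hz, hzx⟩ := hx
    exact ih.tail (mem_induce_edges.2 ⟨hbc, ⟨z, hz, hzx.trans hb⟩, ⟨z, hz, (hzx.trans hb).tail hbc⟩⟩)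

lemma Above.of_reach {t : OGraph α} {c : Finset α} {x y : α} (hx : t.Above c x)
    (h : t.Reach x y) : t.Above c y := by
  obtain ⟨z, hz, hzx⟩ := hx
  exact ⟨z, hz, hzx.trans h⟩

lemma induce_isSub (t : OGraph α) (p : α → Prop) : (t.induce p).IsSub t :=
  ⟨fun _ h => (mem_induce_verts.1 h).1, fun ⟨_, _⟩ h => (mem_induce_edges.1 h).1⟩

lemma IsSub.trans {r s t : OGraph α} (h : r.IsSub s) (h' : s.IsSub t) : r.IsSub t :=
  ⟨h.1.trans h'.1, h.2.trans h'.2⟩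

lemma IsCovering.isSub {s' s : OGraph α} (h : s'.IsCovering s) : s'.IsSub s :=
  ⟨h.1.le, h.2⟩

lemma IsSub.union {s s' t : OGraph α} (h : s.IsSub t) (h' : s'.IsSub t) : (s.union s').IsSub t := by
  classical
  constructor
  · intro x hx
    rcases Finset.mem_union.1 hx with hx | hx
    exacts [h.1 hx, h'.1 hx]
  · intro x hx
    rcases Finset.mem_union.1 hx with hx | hx
    exacts [h.2 hx, h'.2 hx]

/-- A trunk of a tree is a tree or empty. -/
lemma IsTreeOrEmpty.trunk {t : OGraph α} (ht : t.IsTreeOrEmpty) (c : Finset α) :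
    (t.trunk c).IsTreeOrEmpty := by
  rcases ht with h0 | ⟨r, hrv, hr, hu, hc⟩
  · left
    ext x
    simp [OGraph.trunk, mem_induce_verts, h0]
  · by_cases hra : t.Above c r
    · left
      ext x
      simp only [OGraph.trunk, mem_induce_verts, Finset.notMem_empty, iff_false, not_and, not_not]
      intro hx
      exact hra.of_reach (hc x hx)
    · right
      refine ⟨r, mem_induce_verts.2 ⟨hrv, hra⟩, fun x hx => hr x (mem_induce_edges.1 hx).1, ?_, ?_⟩
      · intro y hy hyr
        obtain ⟨hy1, hy2⟩ := mem_induce_verts.1 hy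
        obtain ⟨x, hx, hxu⟩ := hu y hy1 hyr
        exact ⟨x, mem_induce_edges.2 ⟨hx, fun h => hy2 (h.of_reach (.single hx)), hy2⟩,
          fun z hz => hxu z (mem_induce_edges.1 hz).1⟩
      · intro y hy
        obtain ⟨hy1, hy2⟩ := mem_induce_verts.1 hy
        have key : ∀ y, t.Reach r y → ¬ t.Above c y → (t.trunk c).Reach r y := by
          intro y hy
          induction hy with
          | refl => exact fun _ => .refl
          | @tail a b _ hab ih =>
            intro hb
            have ha : ¬ t.Above c a := fun h => hb (h.of_reach (.single hab))
            exact (ih ha).tail (mem_induce_edges.2 ⟨hab, ha, hb⟩)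
        exact key y (hc y hy1) hy2

/-- A path between vertices of a trunk stays in the trunk. -/
lemma reach_trunk {t : OGraph α} {c : Finset α} {x y : α} (h : t.Reach x y)
    (hy : ¬ t.Above c y) : (t.trunk c).Reach x y := by
  induction h with
  | refl => exact .refl
  | @tail a b _ hab ih =>
    have ha : ¬ t.Above c a := fun h => hy (h.of_reach (.single hab))
    exact (ih ha).tail (mem_induce_edges.2 ⟨hab, ha, hy⟩)

/-- Following a path of `t` in `t / s`. -/
lemma IsTreeOrEmpty.reach_contract {t s : OGraph α} (ht : t.IsTreeOrEmpty) (hs : s.IsSub t) {x y : α}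
    (hx : x ∈ (t.contract s).verts) (h : t.Reach x y) :
    ∃ q ∈ (t.contract s).verts, (t.contract s).Reach x q ∧ s.Reach q y := by
  induction h with
  | refl => exact ⟨x, hx, .refl, .refl⟩
  | @tail v w _ hvw ih =>
    obtain ⟨q, hq, hxq, hqv⟩ := ih
    by_cases hw : (v, w) ∈ s.edges
    · exact ⟨q, hq, hxq, hqv.tail hw⟩
    · have hw' : w ∈ (t.contract s).verts :=
        mem_contract_verts.2 ⟨t.tgt_mem _ _ hvw, fun z hz => hw (ht.in_unique hvw (hs.2 hz) ▸ hz)⟩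
      exact ⟨w, hw', hxq.tail (mem_contract_edges.2 ⟨hq, hw', v, hqv, hvw, hw⟩), .refl⟩

lemma reach_eq_of_mem_contract {t s : OGraph α} {q y : α} (hy : y ∈ (t.contract s).verts)
    (h : s.Reach q y) : q = y := by
  rcases Relation.ReflTransGen.cases_tail h with h | ⟨z, _, hz⟩
  · exact h.symm
  · exact absurd hz ((mem_contract_verts.1 hy).2 z)

lemma reach_of_reach_contract {t s : OGraph α} (hs : s.IsSub t) {x y : α}
    (h : (t.contract s).Reach x y) : t.Reach x y := by
  induction h with
  | refl => exact .refl
  | @tail a b _ hab ih =>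
    obtain ⟨_, _, z, hz, hzb, _⟩ := mem_contract_edges.1 hab
    exact (ih.trans (hz.mono hs.2)).tail hzb

lemma IsTreeOrEmpty.reach_contract_iff {t s : OGraph α} (ht : t.IsTreeOrEmpty) (hs : s.IsSub t)
    {x y : α} (hx : x ∈ (t.contract s).verts) (hy : y ∈ (t.contract s).verts) :
    (t.contract s).Reach x y ↔ t.Reach x y := by
  refine ⟨reach_of_reach_contract hs, fun h => ?_⟩
  obtain ⟨q, _, hxq, hqy⟩ := ht.reach_contract hs hx h
  exact reach_eq_of_mem_contract hy hqy ▸ hxq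

/-- A contraction of a tree is a tree. -/
lemma IsTreeOrEmpty.contract {t s : OGraph α} (ht : t.IsTreeOrEmpty) (hs : s.IsSub t) :
    (t.contract s).IsTreeOrEmpty := by
  have ht' := ht
  rcases ht with h0 | ⟨r, hrv, hr, hu, hc⟩
  · left
    ext x
    simp [mem_contract_verts, h0]
  · have hrc : r ∈ (t.contract s).verts :=
      mem_contract_verts.2 ⟨hrv, fun y hy => hr y (hs.2 hy)⟩
    have hreach : ∀ y ∈ (t.contract s).verts, (t.contract s).Reach r y := fun y hy =>
      (ht'.reach_contract_iff hs hrc hy).2 (hc y (mem_contract_verts.1 hy).1)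
    refine Or.inr ⟨r, hrc, fun x hx => ?_, fun y hy hyr => ?_, hreach⟩
    · obtain ⟨_, _, z, _, hz, _⟩ := mem_contract_edges.1 hx
      exact hr z hz
    · rcases Relation.ReflTransGen.cases_tail (hreach y hy) with h | ⟨q, _, hq⟩
      · exact absurd h hyr
      · refine ⟨q, hq, fun q' hq' => ?_⟩
        obtain ⟨hqv, _, z, hz, hzy, _⟩ := mem_contract_edges.1 hq
        obtain ⟨hqv', _, z', hz', hzy', _⟩ := mem_contract_edges.1 hq'
        obtain rfl := ht'.in_unique hzy hzy'
        rcases ht'.reach_total hs hz hz' with h | h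
        · exact (reach_eq_of_mem_contract hqv' h).symm
        · exact reach_eq_of_mem_contract hqv h

/-- A cut of `t` that does not meet `s` is a cut of `t / s`. -/
lemma IsAdm.contract {t s : OGraph α} (hs : s.IsSub t) {c : Finset α} (hc : t.IsAdm c)
    (hm : ¬ Meets c s) : (t.contract s).IsAdm c :=
  ⟨fun x hx => mem_contract_verts.2 ⟨hc.1 hx, fun y hy => hm ⟨x, hx, y, hy⟩⟩,
    fun x hx y hy h => hc.2 x hx y hy (reach_of_reach_contract hs h)⟩

end OGraph

open OGraph

variable {α : Type*}

/-- The couples `(t, s)` with `t` a rooted tree (or empty) and `s = P^c(t)` for an admissible cut `c`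
of `t`. -/
def IsPruningPair (t s : OGraph α) : Prop :=
  t.IsTreeOrEmpty ∧ ∃ c, t.IsAdm c ∧ s = t.prune c

/-- The couples `(t, s)` with `t` a rooted tree (or empty) and `s` a subforest of `t`. -/
def IsSubforestPair (t s : OGraph α) : Prop :=
  t.IsTreeOrEmpty ∧ s.IsSub t

lemma IsPruningPair.isSub {t s : OGraph α} (h : IsPruningPair t s) : s.IsSub t := by
  obtain ⟨_, c, _, rfl⟩ := h
  exact induce_isSub _ _

lemma reach_prune_iff {t : OGraph α} {c : Finset α} {x y : α} (hx : x ∈ (t.prune c).verts) :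
    (t.prune c).Reach x y ↔ t.Reach x y :=
  ⟨fun h => h.mono (induce_isSub t _).2,
    fun h => reach_induce_of_reach (mem_induce_verts.1 hx).2 h⟩

lemma above_prune_iff {t : OGraph α} {c₀ c : Finset α} {y : α} (hc : c ⊆ (t.prune c₀).verts) :
    (t.prune c₀).Above c y ↔ t.Above c y :=
  exists_congr fun _ => and_congr_right fun hx => reach_prune_iff (hc hx)

/-- An admissible cut of a pruning of `t` is an admissible cut of `t`. -/
lemma IsPruningPair.isAdm {t s : OGraph α} (h : IsPruningPair t s) {c : Finset α} (hc : s.IsAdm c) :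
    t.IsAdm c := by
  have hs := h.isSub
  obtain ⟨_, c₀, _, rfl⟩ := h
  exact ⟨hc.1.trans hs.1, fun x hx y hy hxy => hc.2 x hx y hy ((reach_prune_iff (hc.1 hx)).2 hxy)⟩

/-- `(t, P^c(s))` is in `V`. -/
lemma IsPruningPair.prune {t s : OGraph α} (h : IsPruningPair t s) {c : Finset α} (hc : s.IsAdm c) :
    IsPruningPair t (s.prune c) := by
  refine ⟨h.1, c, h.isAdm hc, ?_⟩
  obtain ⟨_, c₀, _, rfl⟩ := h
  have key : ∀ y, t.Above c y → t.Above c₀ y := by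
    rintro y ⟨x, hx, hxy⟩
    exact (mem_induce_verts.1 (hc.1 hx)).2.of_reach hxy
  refine OGraph.ext (Finset.ext fun x => ?_) (Finset.ext fun ⟨x, y⟩ => ?_)
  · simp only [OGraph.prune, mem_induce_verts]
    rw [← OGraph.prune, above_prune_iff hc.1]
    exact ⟨fun h => ⟨h.1.1, h.2⟩, fun h => ⟨⟨h.1, key _ h.2⟩, h.2⟩⟩
  · simp only [OGraph.prune, mem_induce_edges]
    rw [← OGraph.prune, above_prune_iff hc.1, above_prune_iff hc.1]
    exact ⟨fun h => ⟨h.1.1, h.2⟩, fun h => ⟨⟨h.1, key _ h.2.1, key _ h.2.2⟩, h.2⟩⟩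

/-- `(R^c(t), R^c(s))` is in `V`. -/
lemma IsPruningPair.trunk {t s : OGraph α} (h : IsPruningPair t s) {c : Finset α} (hc : s.IsAdm c) :
    IsPruningPair (t.trunk c) (s.trunk c) := by
  classical
  refine ⟨h.1.trunk c, ?_⟩
  obtain ⟨_, c₀, hc₀, rfl⟩ := h
  have key : ∀ y, ¬ t.Above c y →
      ((t.trunk c).Above (c₀.filter fun x => ¬ t.Above c x) y ↔ t.Above c₀ y) := by
    intro y hy
    constructor
    · rintro ⟨x, hx, hxy⟩
      exact ⟨x, (Finset.mem_filter.1 hx).1, hxy.mono (induce_isSub t _).2⟩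
    · rintro ⟨x, hx, hxy⟩
      exact ⟨x, Finset.mem_filter.2 ⟨hx, fun h => hy (h.of_reach hxy)⟩, reach_trunk hxy hy⟩
  refine ⟨c₀.filter fun x => ¬ t.Above c x, ⟨fun x hx => ?_, fun x hx y hy hxy => ?_⟩, ?_⟩
  · obtain ⟨h1, h2⟩ := Finset.mem_filter.1 hx
    exact mem_induce_verts.2 ⟨hc₀.1 h1, h2⟩
  · exact hc₀.2 x (Finset.mem_filter.1 hx).1 y (Finset.mem_filter.1 hy).1
      (hxy.mono (induce_isSub t _).2)
  · refine OGraph.ext (Finset.ext fun x => ?_) (Finset.ext fun ⟨x, y⟩ => ?_)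
    · simp only [OGraph.trunk, OGraph.prune, mem_induce_verts]
      rw [← OGraph.prune, ← OGraph.trunk, above_prune_iff hc.1]
      constructor
      · rintro ⟨⟨h1, h2⟩, h3⟩
        exact ⟨⟨h1, h3⟩, (key _ h3).2 h2⟩
      · rintro ⟨⟨h1, h3⟩, h2⟩
        exact ⟨⟨h1, (key _ h3).1 h2⟩, h3⟩
    · simp only [OGraph.trunk, OGraph.prune, mem_induce_edges]
      rw [← OGraph.prune, ← OGraph.trunk, above_prune_iff hc.1, above_prune_iff hc.1]
      constructor
      · rintro ⟨⟨h1, h2, h2'⟩, h3, h3'⟩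
        exact ⟨⟨h1, h3, h3'⟩, (key _ h3).2 h2, (key _ h3').2 h2'⟩
      · rintro ⟨⟨h1, h3, h3'⟩, h2, h2'⟩
        exact ⟨⟨h1, (key _ h3).1 h2, (key _ h3').1 h2'⟩, h3, h3'⟩

/-- `(t, s')` is in `Ṽ`. -/
lemma IsPruningPair.covering {t s s' : OGraph α} (h : IsPruningPair t s) (hs' : s'.IsCovering s) :
    IsSubforestPair t s' :=
  ⟨h.1, hs'.isSub.trans h.isSub⟩

/-- `(t / s', s / s')` is in `V`. -/
lemma IsPruningPair.contract {t s s' : OGraph α} (h : IsPruningPair t s) (hs' : s'.IsCovering s) :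
    IsPruningPair (t.contract s') (s.contract s') := by
  have hsub : s'.IsSub t := hs'.isSub.trans h.isSub
  refine ⟨h.1.contract hsub, ?_⟩
  obtain ⟨ht, c₀, hc₀, rfl⟩ := h
  have hm : ¬ Meets c₀ s' := by
    rintro ⟨x, hx, y, hyx⟩
    obtain ⟨h1, ⟨z, hz, hzy⟩, _⟩ := mem_induce_edges.1 (hs'.2 hyx)
    obtain rfl := hc₀.2 z hz x hx (hzy.tail h1)
    exact ht.acyclic z (Relation.TransGen.tail' hzy h1)
  have hc := hc₀.contract hsub hm
  have key : ∀ y ∈ (t.contract s').verts, ((t.contract s').Above c₀ y ↔ t.Above c₀ y) :=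
    fun y hy => exists_congr fun x => and_congr_right fun hx =>
      ht.reach_contract_iff hsub (hc.1 hx) hy
  refine ⟨c₀, hc, ?_⟩
  have hv : ∀ x, x ∈ ((t.prune c₀).contract s').verts ↔
      x ∈ (t.contract s').verts ∧ t.Above c₀ x := by
    intro x
    simp only [mem_contract_verts, OGraph.prune, mem_induce_verts]
    tauto
  refine OGraph.ext (Finset.ext fun x => ?_) (Finset.ext fun ⟨x, y⟩ => ?_)
  · rw [hv, OGraph.prune, mem_induce_verts]
    exact and_congr_right fun h => (key _ h).symm
  · rw [mem_contract_edges, hv, hv, OGraph.prune, OGraph.prune, mem_induce_edges,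
      mem_contract_edges]
    constructor
    · rintro ⟨⟨h1, h2⟩, ⟨h3, h4⟩, z, h5, h6, h7⟩
      exact ⟨⟨h1, h3, z, h5, (mem_induce_edges.1 h6).1, h7⟩, (key _ h1).2 h2, (key _ h3).2 h4⟩
    · rintro ⟨⟨h1, h3, z, h5, h6, h7⟩, h2, h4⟩
      have h2 := (key _ h1).1 h2
      have h4 := (key _ h3).1 h4
      exact ⟨⟨h1, h2⟩, ⟨h3, h4⟩, z, h5,
        mem_induce_edges.2 ⟨h6, h2.of_reach (h5.mono hsub.2), h4⟩, h7⟩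

/-- The basis of `V`. -/
structure PruningPair (α : Type*) where
  t : OGraph α
  s : OGraph α
  prop : IsPruningPair t s

/-- The basis of `Ṽ`. -/
structure SubforestPair (α : Type*) where
  t : OGraph α
  s : OGraph α
  prop : IsSubforestPair t s

section Maps

variable (K : Type*) [Field K] (α : Type*)

/-- The vector space `V`. -/
abbrev V : Type _ := PruningPair α →₀ K

/-- The vector space `Ṽ`. -/
abbrev Vt : Type _ := SubforestPair α →₀ K

/-- The coproduct `Δ(t, s) = ∑_{c ∈ Adm(s)} (t, P^c(s)) ⊗ (R^c(t), R^c(s))` on `V`. -/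
noncomputable def delta : V K α →ₗ[K] V K α ⊗[K] V K α :=
  Finsupp.linearCombination K fun p =>
    ∑ c : {c // c ∈ p.s.adm},
      (Finsupp.single ⟨p.t, p.s.prune c, p.prop.prune (mem_adm.1 c.2)⟩ 1 : V K α) ⊗ₜ[K]
        (Finsupp.single ⟨p.t.trunk c, p.s.trunk c, p.prop.trunk (mem_adm.1 c.2)⟩ 1 : V K α)

/-- The coaction `φ(t, s) = ∑_{s' ⊆ s} (t, s') ⊗ (t / s', s / s')` of `Ṽ` on `V`. -/
noncomputable def phi : V K α →ₗ[K] Vt K α ⊗[K] V K α :=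
  Finsupp.linearCombination K fun p =>
    ∑ s' : {s' // s' ∈ p.s.coverings},
      (Finsupp.single ⟨p.t, s', p.prop.covering (mem_coverings.1 s'.2)⟩ 1 : Vt K α) ⊗ₜ[K]
        (Finsupp.single
          ⟨p.t.contract s', p.s.contract s', p.prop.contract (mem_coverings.1 s'.2)⟩ 1 : V K α)

variable {α}

/-- The conditions under which `ξ((t', s') ⊗ (t'', s'') ⊗ (u, v))` is not zero, the cut `c̃` being
given: `t'' = R^c(t')` for an admissible cut `c` of `t'`, `u = t' / s'`, and `v` is the pruning at
`c̃`, an admissible cut of `t'` which does not meet `s'` and `s''`. As `c̃` does not meet `s'`, it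
is also a cut of `u = t' / s'`, and `v ⊆ u` is the image in `u` of the pruning of `t'`. -/
def XiMatch (a b : SubforestPair α) (d : PruningPair α) (ct : Finset α) : Prop :=
  (∃ c, a.t.IsAdm c ∧ b.t = a.t.trunk c) ∧
    a.t.IsAdm ct ∧ ¬ Meets ct a.s ∧ ¬ Meets ct b.s ∧
      d.t = a.t.contract a.s ∧ d.s = (a.t.contract a.s).prune ct

/-- The cut `c̃` is determined by `(t', s')` and `(u, v)`. -/
lemma XiMatch.unique {a b : SubforestPair α} {d : PruningPair α} {ct ct' : Finset α}
    (h : XiMatch a b d ct) (h' : XiMatch a b d ct') : ct = ct' :=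
  (a.prop.1.contract a.prop.2).cut_unique (h.2.1.contract a.prop.2 h.2.2.1)
    (h'.2.1.contract a.prop.2 h'.2.2.1) (h.2.2.2.2.2.symm.trans h'.2.2.2.2.2)

lemma XiMatch.isSub {a b : SubforestPair α} {d : PruningPair α} {ct : Finset α}
    (h : XiMatch a b d ct) : (a.s.union b.s).IsSub a.t := by
  obtain ⟨⟨c, _, hb⟩, _⟩ := h
  refine a.prop.2.union (b.prop.2.trans ?_)
  rw [hb]
  exact induce_isSub _ _

lemma XiMatch.isPruningPair {a b : SubforestPair α} {d : PruningPair α} {ct : Finset α}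
    (h : XiMatch a b d ct) : IsPruningPair (a.t.contract (a.s.union b.s))
      ((a.t.contract (a.s.union b.s)).prune ct) := by
  classical
  refine ⟨a.prop.1.contract h.isSub, ct, h.2.1.contract h.isSub ?_, rfl⟩
  rintro ⟨x, hx, y, hy⟩
  rcases Finset.mem_union.1 hy with hy | hy
  · exact h.2.2.1 ⟨x, hx, y, hy⟩
  · exact h.2.2.2.1 ⟨x, hx, y, hy⟩

open Classical in
/-- The values of `ξ` on basis elements: `(t', s' ∪ s'') ⊗ (t' / (s' ∪ s''), v)` under the conditions
above, and `0` otherwise; `v` is viewed in `t' / (s' ∪ s'')` as the pruning at the cut `c̃`. -/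
noncomputable def xiBasis (a b : SubforestPair α) (d : PruningPair α) : Vt K α ⊗[K] V K α :=
  if h : ∃ ct, XiMatch a b d ct then
    (Finsupp.single ⟨a.t, a.s.union b.s, a.prop.1, h.choose_spec.isSub⟩ 1 : Vt K α) ⊗ₜ[K]
      (Finsupp.single ⟨a.t.contract (a.s.union b.s),
        (a.t.contract (a.s.union b.s)).prune h.choose, h.choose_spec.isPruningPair⟩ 1 : V K α)
  else 0

variable (α)

/-- The map `ξ : Ṽ ⊗ Ṽ ⊗ V → Ṽ ⊗ V`. -/
noncomputable def xi : (Vt K α ⊗[K] Vt K α) ⊗[K] V K α →ₗ[K] Vt K α ⊗[K] V K α :=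
  TensorProduct.lift <| TensorProduct.lift <|
    Finsupp.linearCombination K fun a => Finsupp.linearCombination K fun b =>
      Finsupp.linearCombination K fun d => xiBasis K a b d

/-- `τ²³` exchanges the two middle factors. -/
noncomputable def tau23 : (Vt K α ⊗[K] V K α) ⊗[K] (Vt K α ⊗[K] V K α) →ₗ[K]
    (Vt K α ⊗[K] Vt K α) ⊗[K] (V K α ⊗[K] V K α) :=
  (TensorProduct.tensorTensorTensorComm K (Vt K α) (V K α) (Vt K α) (V K α)).toLinearMap

/-- `ξ ⊗ id`, up to the standard rebracketings of the tensor products. -/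
noncomputable def xiTensorId : (Vt K α ⊗[K] Vt K α) ⊗[K] (V K α ⊗[K] V K α) →ₗ[K]
    Vt K α ⊗[K] (V K α ⊗[K] V K α) :=
  (TensorProduct.assoc K (Vt K α) (V K α) (V K α)).toLinearMap ∘ₗ
    TensorProduct.map (xi K α) LinearMap.id ∘ₗ
      (TensorProduct.assoc K (Vt K α ⊗[K] Vt K α) (V K α) (V K α)).symm.toLinearMap

end Maps

end TreeDoubling

namespace TreeDoubling

open OGraph

variable {α : Type*}

/-! ### Reachability, prunings and trunks under contraction -/

namespace OGraph

/-! On a basis element `(t, s)` both sides are sums over essentially the same data. The left side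
runs over pairs `(s', c)`, with `s'` a covering subforest of `s` and `c` an admissible cut of `s /
s'`. The right side runs over triples `(c, a, b)`, with `c` an admissible cut of `s` and `a`, `b`
covering subforests of the pruning and the trunk at `c`. The map `(c, a, b) ↦ (a ∪ b, c)` is a
bijection: an admissible cut of `s / s'` is an admissible cut of `s` that contains no edge of `s'`,
and along such a cut `s'` falls apart into its part above and its part below
(`IsSplitting.isAdm_contract`, `IsPruningPair.exists_isSplitting`, `IsSplitting.unique`).

Corresponding terms agree. The cut `c` itself serves as `c̃`, so `ξ` never vanishes here
(`IsSplitting.xiMatch`), and what remains is that pruning and trunk are compatible with contraction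
(`IsSplitting.prune_contract_union`, `IsSplitting.trunk_contract_tree`,
`IsSplitting.trunk_contract_forest`). This all rests on one fact: between vertices that survive a
contraction, reachability is the same before and after. Since edges are named by their upper
endpoint, the same finite set `c` denotes the cut in `s`, `t` and their contractions. -/

lemma mem_union_verts {s t : OGraph α} {x : α} :
    x ∈ (s.union t).verts ↔ x ∈ s.verts ∨ x ∈ t.verts := by
  simp [union]

lemma mem_union_edges {s t : OGraph α} {x y : α} :
    (x, y) ∈ (s.union t).edges ↔ (x, y) ∈ s.edges ∨ (x, y) ∈ t.edges := by
  simp [union]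

/-- For vertices of `t / s`, lying above a cut means the same in `t / s` and in `t`. -/
lemma IsTreeOrEmpty.above_contract_iff {t s : OGraph α} (ht : t.IsTreeOrEmpty) (hs : s.IsSub t)
    {c : Finset α} (hc : c ⊆ (t.contract s).verts) {y : α} (hy : y ∈ (t.contract s).verts) :
    (t.contract s).Above c y ↔ t.Above c y :=
  exists_congr fun _ => and_congr_right fun hx => ht.reach_contract_iff hs (hc hx) hy

/-- A vertex above `c` whose parent is not above `c` belongs to `c`. -/
lemma IsTreeOrEmpty.mem_of_above {t : OGraph α} (ht : t.IsTreeOrEmpty) {c : Finset α} {x y : α}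
    (hxy : (x, y) ∈ t.edges) (hx : ¬ t.Above c x) (hy : t.Above c y) : y ∈ c := by
  obtain ⟨z, hz, hzy⟩ := hy
  rcases Relation.ReflTransGen.cases_tail hzy with h | ⟨w, hzw, hwy⟩
  · exact h ▸ hz
  · obtain rfl := ht.in_unique hwy hxy
    exact absurd ⟨z, hz, hzw⟩ hx

/-- A vertex whose parent lies above an admissible cut does not belong to the cut. -/
lemma IsTreeOrEmpty.notMem_of_edge_above {t : OGraph α} (ht : t.IsTreeOrEmpty) {c : Finset α}
    (hc : t.IsAdm c) {x y : α} (hxy : (x, y) ∈ t.edges) (hx : t.Above c x) : y ∉ c := by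
  intro hy
  obtain ⟨z, hz, hzx⟩ := hx
  obtain rfl := hc.2 z hz y hy (hzx.tail hxy)
  exact ht.acyclic z (Relation.TransGen.tail' hzx hxy)

/-- Trunks commute with contractions. -/
lemma trunk_contract {g s b : OGraph α} (hs : s.IsSub g) {c : Finset α}
    (hA : ∀ y ∈ (g.contract s).verts, ((g.contract s).Above c y ↔ g.Above c y))
    (hb : ∀ x y, (x, y) ∈ b.edges ↔ (x, y) ∈ s.edges ∧ ¬ g.Above c y) :
    (g.contract s).trunk c = (g.trunk c).contract b := by
  have hv : ∀ x, x ∈ ((g.trunk c).contract b).verts ↔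
      x ∈ (g.contract s).verts ∧ ¬ g.Above c x := by
    intro x
    simp only [mem_contract_verts, trunk, mem_induce_verts, hb]
    exact ⟨fun h => ⟨⟨h.1.1, fun y hy => h.2 y ⟨hy, h.1.2⟩⟩, h.1.2⟩,
      fun h => ⟨⟨h.1.1, h.2⟩, fun y hy => h.1.2 y hy.1⟩⟩
  -- Being above `c` is inherited upwards, so a path of `s` ending outside the pruning never enters
  -- it, and all its edges belong to `b`.
  have hr : ∀ {r x}, s.Reach r x → ¬ g.Above c x → b.Reach r x := by
    intro r x h
    induction h with
    | refl => exact fun _ => .refl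
    | @tail u w _ huw ih =>
      intro hw
      exact (ih fun h => hw (h.of_reach (.single (hs.2 huw)))).tail ((hb _ _).2 ⟨huw, hw⟩)
  refine OGraph.ext (Finset.ext fun x => ?_) (Finset.ext fun ⟨x, y⟩ => ?_)
  · rw [hv, trunk, mem_induce_verts]
    exact and_congr_right fun h => not_congr (hA _ h)
  · rw [mem_contract_edges, hv, hv, trunk, trunk, mem_induce_edges, mem_contract_edges]
    constructor
    · rintro ⟨⟨h1, h2, z, h3, h4, h5⟩, h6, h7⟩
      rw [hA _ h1] at h6
      rw [hA _ h2] at h7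
      have hz : ¬ g.Above c z := fun h => h7 (h.of_reach (.single h4))
      exact ⟨⟨h1, h6⟩, ⟨h2, h7⟩, z, hr h3 hz, mem_induce_edges.2 ⟨h4, hz, h7⟩,
        fun h => h5 ((hb _ _).1 h).1⟩
    · rintro ⟨⟨h1, h6⟩, ⟨h2, h7⟩, z, h3, h4, h5⟩
      refine ⟨⟨h1, h2, z, h3.mono fun ⟨_, _⟩ h => ((hb _ _).1 h).1, (mem_induce_edges.1 h4).1,
        fun h => h5 ((hb _ _).2 ⟨h, h7⟩)⟩, ?_, ?_⟩
      · rwa [hA _ h1]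
      · rwa [hA _ h2]

/-- Prunings commute with contractions. -/
lemma IsTreeOrEmpty.prune_contract {t a : OGraph α} (ht : t.IsTreeOrEmpty) {c : Finset α}
    (hc : t.IsAdm c) (ha : a.IsSub (t.prune c)) :
    (t.prune c).contract a = (t.contract a).prune c := by
  have hsub : a.IsSub t := ha.trans (induce_isSub _ _)
  -- Contraction removes only targets of edges of `a`. Such an edge starts above `c`, so by
  -- admissibility its target is not in `c`.
  have hca : c ⊆ (t.contract a).verts := fun x hx => mem_contract_verts.2 ⟨hc.1 hx, fun y hy => by
    obtain ⟨h1, h2, _⟩ := mem_induce_edges.1 (ha.2 hy)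
    exact ht.notMem_of_edge_above hc h1 h2 hx⟩
  have key : ∀ y ∈ (t.contract a).verts, ((t.contract a).Above c y ↔ t.Above c y) :=
    fun y hy => ht.above_contract_iff hsub hca hy
  have hv : ∀ x, x ∈ ((t.prune c).contract a).verts ↔
      x ∈ (t.contract a).verts ∧ t.Above c x := by
    intro x
    simp only [mem_contract_verts, OGraph.prune, mem_induce_verts]
    tauto
  refine OGraph.ext (Finset.ext fun x => ?_) (Finset.ext fun ⟨x, y⟩ => ?_)
  · rw [hv, OGraph.prune, mem_induce_verts]
    exact and_congr_right fun h => (key _ h).symm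
  · rw [mem_contract_edges, hv, hv, OGraph.prune, OGraph.prune, mem_induce_edges,
      mem_contract_edges]
    constructor
    · rintro ⟨⟨h1, h2⟩, ⟨h3, h4⟩, z, h5, h6, h7⟩
      exact ⟨⟨h1, h3, z, h5, (mem_induce_edges.1 h6).1, h7⟩, (key _ h1).2 h2, (key _ h3).2 h4⟩
    · rintro ⟨⟨h1, h3, z, h5, h6, h7⟩, h2, h4⟩
      have h2 := (key _ h1).1 h2
      have h4 := (key _ h3).1 h4
      exact ⟨⟨h1, h2⟩, ⟨h3, h4⟩, z, h5,
        mem_induce_edges.2 ⟨h6, h2.of_reach (h5.mono hsub.2), h4⟩, h7⟩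

end OGraph

/-! ### Cuts of a pruning, seen in the ambient tree -/

lemma IsPruningPair.above_iff {t s : OGraph α} (h : IsPruningPair t s) {c : Finset α}
    (hc : c ⊆ s.verts) {y : α} : s.Above c y ↔ t.Above c y := by
  obtain ⟨_, c₀, _, rfl⟩ := h
  exact above_prune_iff hc

/-- A pruning of a pruning `s` of `t` is a pruning of `t`. -/
lemma IsPruningPair.prune_eq {t s : OGraph α} (h : IsPruningPair t s) {c : Finset α}
    (hc : c ⊆ s.verts) : s.prune c = t.prune c := by
  obtain ⟨_, c₀, _, rfl⟩ := h
  have key : ∀ y, t.Above c y → t.Above c₀ y := by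
    rintro y ⟨x, hx, hxy⟩
    exact (mem_induce_verts.1 (hc hx)).2.of_reach hxy
  refine OGraph.ext (Finset.ext fun x => ?_) (Finset.ext fun ⟨x, y⟩ => ?_)
  · rw [OGraph.prune, mem_induce_verts, above_prune_iff hc, OGraph.prune, OGraph.prune, mem_induce_verts,
      mem_induce_verts]
    exact ⟨fun h => ⟨h.1.1, h.2⟩, fun h => ⟨⟨h.1, key _ h.2⟩, h.2⟩⟩
  · rw [OGraph.prune, mem_induce_edges, above_prune_iff hc, above_prune_iff hc, OGraph.prune,
      OGraph.prune,
      mem_induce_edges, mem_induce_edges]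
    exact ⟨fun h => ⟨h.1.1, h.2⟩, fun h => ⟨⟨h.1, key _ h.2.1, key _ h.2.2⟩, h.2⟩⟩

/-! ### Splitting a covering subforest along a cut -/

/-- A covering subforest of the pruning and one of the trunk at a cut `c`: the data that is summed
over in `(φ ⊗ φ) ∘ Δ`. -/
structure IsSplitting (t s : OGraph α) (c : Finset α) (a b : OGraph α) : Prop where
  pair : IsPruningPair t s
  adm : s.IsAdm c
  left : a.IsCovering (s.prune c)
  right : b.IsCovering (s.trunk c)

namespace IsSplitting

variable {t s a b : OGraph α} {c : Finset α}

lemma above_iff (h : IsSplitting t s c a b) {y : α} : s.Above c y ↔ t.Above c y :=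
  h.pair.above_iff h.adm.1

lemma left_edge (h : IsSplitting t s c a b) {x y : α} (hxy : (x, y) ∈ a.edges) :
    (x, y) ∈ s.edges ∧ s.Above c x ∧ s.Above c y :=
  mem_induce_edges.1 (h.left.2 hxy)

lemma right_edge (h : IsSplitting t s c a b) {x y : α} (hxy : (x, y) ∈ b.edges) :
    (x, y) ∈ s.edges ∧ ¬ s.Above c x ∧ ¬ s.Above c y :=
  mem_induce_edges.1 (h.right.2 hxy)

lemma union_isCovering (h : IsSplitting t s c a b) : (a.union b).IsCovering s := by
  refine ⟨Finset.ext fun x => ?_, fun ⟨x, y⟩ hxy => ?_⟩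
  · rw [mem_union_verts, h.left.1, h.right.1, prune, trunk, mem_induce_verts, mem_induce_verts]
    tauto
  · rcases mem_union_edges.1 hxy with hxy | hxy
    exacts [(h.left_edge hxy).1, (h.right_edge hxy).1]

/-- Every edge of `a` starts above the cut, while by admissibility no member of the cut has its
parent above the cut. -/
lemma not_meets_left (h : IsSplitting t s c a b) : ¬ Meets c a := by
  rintro ⟨y, hy, x, hxy⟩
  obtain ⟨h1, h2, _⟩ := h.left_edge hxy
  exact h.pair.1.notMem_of_edge_above (h.pair.isAdm h.adm) (h.pair.isSub.2 h1)
    (h.above_iff.1 h2) hy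

lemma not_meets_right (h : IsSplitting t s c a b) : ¬ Meets c b := by
  rintro ⟨y, hy, x, hxy⟩
  exact (h.right_edge hxy).2.2 ⟨y, hy, .refl⟩

/-- The members of `c` survive the contraction because neither part contains an edge of the cut.
This makes `(c, a, b) ↦ (a ∪ b, c)` land in the index set of the left side. -/
lemma isAdm_contract (h : IsSplitting t s c a b) : (s.contract (a.union b)).IsAdm c := by
  refine h.adm.contract h.union_isCovering.isSub ?_
  rintro ⟨y, hy, x, hxy⟩
  rcases mem_union_edges.1 hxy with hxy | hxy
  exacts [h.not_meets_left ⟨y, hy, x, hxy⟩, h.not_meets_right ⟨y, hy, x, hxy⟩]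

/-- Edges of `a` lie wholly above the cut and edges of `b` wholly outside, so the target alone
decides where an edge of the union belongs. This recovers the parts from the union, and is also the
edge condition required by `OGraph.trunk_contract`. -/
lemma right_edge_iff (h : IsSplitting t s c a b) {x y : α} :
    (x, y) ∈ b.edges ↔ (x, y) ∈ (a.union b).edges ∧ ¬ s.Above c y := by
  rw [mem_union_edges]
  refine ⟨fun hxy => ⟨Or.inr hxy, (h.right_edge hxy).2.2⟩, ?_⟩
  rintro ⟨hxy | hxy, hy⟩
  · exact absurd (h.left_edge hxy).2.2 hy
  · exact hxy

lemma left_edge_iff (h : IsSplitting t s c a b) {x y : α} :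
    (x, y) ∈ a.edges ↔ (x, y) ∈ (a.union b).edges ∧ s.Above c y := by
  rw [mem_union_edges]
  refine ⟨fun hxy => ⟨Or.inl hxy, (h.left_edge hxy).2.2⟩, ?_⟩
  rintro ⟨hxy | hxy, hy⟩
  · exact hxy
  · exact absurd hy (h.right_edge hxy).2.2

/-- The two parts of a splitting are determined by their union. -/
lemma unique {a' b' : OGraph α} (h : IsSplitting t s c a b) (h' : IsSplitting t s c a' b')
    (heq : a.union b = a'.union b') : a = a' ∧ b = b' := by
  constructor
  · refine OGraph.ext (h.left.1.trans h'.left.1.symm) (Finset.ext fun ⟨x, y⟩ => ?_)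
    rw [h.left_edge_iff, h'.left_edge_iff, heq]
  · refine OGraph.ext (h.right.1.trans h'.right.1.symm) (Finset.ext fun ⟨x, y⟩ => ?_)
    rw [h.right_edge_iff, h'.right_edge_iff, heq]

/-- The contracted forest is again a pruning of the contracted tree, so pruning it further is
pruning the tree. `Δ` produces the forest form and `ξ` the tree form. -/
lemma prune_contract_union (h : IsSplitting t s c a b) :
    (s.contract (a.union b)).prune c = (t.contract (a.union b)).prune c :=
  (h.pair.contract h.union_isCovering).prune_eq h.isAdm_contract.1

lemma above_contract_union (h : IsSplitting t s c a b) {y : α}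
    (hy : y ∈ (t.contract (a.union b)).verts) :
    (t.contract (a.union b)).Above c y ↔ t.Above c y :=
  h.pair.1.above_contract_iff (h.union_isCovering.isSub.trans h.pair.isSub)
    (h.isAdm_contract.1.trans (h.pair.contract h.union_isCovering).isSub.1) hy

lemma trunk_contract_tree (h : IsSplitting t s c a b) :
    (t.contract (a.union b)).trunk c = (t.trunk c).contract b :=
  OGraph.trunk_contract (h.union_isCovering.isSub.trans h.pair.isSub)
    (fun _ hy => h.above_contract_union hy) fun x y => by rw [h.right_edge_iff, h.above_iff]

/-- The comparison of `Above` before and after contraction is known for trees only, and `s` is a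
forest. It is therefore carried out in `t` and transported back along the two pruning pairs. -/
lemma trunk_contract_forest (h : IsSplitting t s c a b) :
    (s.contract (a.union b)).trunk c = (s.trunk c).contract b :=
  OGraph.trunk_contract h.union_isCovering.isSub
    (fun _ hy => by
      have hp := h.pair.contract h.union_isCovering
      rw [hp.above_iff h.isAdm_contract.1, h.above_contract_union (hp.isSub.1 hy), h.above_iff])
    fun x y => h.right_edge_iff

end IsSplitting

/-- Every covering subforest not met by a cut `c` comes from a splitting at `c`. -/
lemma IsPruningPair.exists_isSplitting {t s s' : OGraph α} (h : IsPruningPair t s)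
    (hs' : s'.IsCovering s) {c : Finset α} (hc : (s.contract s').IsAdm c) :
    ∃ a b, IsSplitting t s c a b ∧ a.union b = s' := by
  have hsub := hs'.isSub.trans h.isSub
  have hcs : c ⊆ s.verts := fun x hx => (mem_contract_verts.1 (hc.1 hx)).1
  have hp := h.contract hs'
  have hct := hp.isAdm hc
  -- A path of `s` between two members of `c` is a path of `t`, hence gives one in `t / s'`, where
  -- `c` is admissible.
  have hadm : s.IsAdm c := ⟨hcs, fun x hx y hy hxy => hct.2 x hx y hy
    ((h.1.reach_contract_iff hsub (hct.1 hx) (hct.1 hy)).2 (hxy.mono h.isSub.2))⟩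
  refine ⟨s'.induce (s.Above c), s'.induce fun y => ¬ s.Above c y, ⟨h, hadm, ?_, ?_⟩, ?_⟩
  · refine ⟨Finset.ext fun x => ?_, fun ⟨x, y⟩ hxy => ?_⟩
    · rw [OGraph.prune, mem_induce_verts, mem_induce_verts, hs'.1]
    · rw [mem_induce_edges] at hxy
      exact mem_induce_edges.2 ⟨hs'.2 hxy.1, hxy.2⟩
  · refine ⟨Finset.ext fun x => ?_, fun ⟨x, y⟩ hxy => ?_⟩
    · rw [OGraph.trunk, mem_induce_verts, mem_induce_verts, hs'.1]
    · rw [mem_induce_edges] at hxy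
      exact mem_induce_edges.2 ⟨hs'.2 hxy.1, hxy.2⟩
  · refine OGraph.ext (Finset.ext fun x => ?_) (Finset.ext fun ⟨x, y⟩ => ?_)
    · rw [mem_union_verts, mem_induce_verts, mem_induce_verts]
      tauto
    · rw [mem_union_edges, mem_induce_edges, mem_induce_edges]
      refine ⟨fun h => h.elim (·.1) (·.1), fun hxy => ?_⟩
      by_cases hx : s.Above c x
      · exact Or.inl ⟨hxy, hx, hx.of_reach (.single (hs'.2 hxy))⟩
      -- An edge of `s'` crossing the cut would have its target in `c`. But members of `c` are
      -- vertices of `s / s'`, which have no incoming edge in `s'`.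
      · refine Or.inr ⟨hxy, hx, fun hy => ?_⟩
        rw [h.above_iff hcs] at hx hy
        have hyc := h.1.mem_of_above (hsub.2 hxy) hx hy
        exact (mem_contract_verts.1 (hc.1 hyc)).2 x hxy

/-! ### Values of the maps on basis elements -/

section Maps

variable (K : Type*) [Field K]

lemma delta_single (p : PruningPair α) : delta K α (Finsupp.single p 1) =
    ∑ c : {c // c ∈ p.s.adm},
      (Finsupp.single ⟨p.t, p.s.prune c, p.prop.prune (mem_adm.1 c.2)⟩ 1 : V K α) ⊗ₜ[K]
        (Finsupp.single
          ⟨p.t.trunk c, p.s.trunk c, p.prop.trunk (mem_adm.1 c.2)⟩ 1 : V K α) := by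
  simp [delta]

lemma phi_single (p : PruningPair α) : phi K α (Finsupp.single p 1) =
    ∑ s' : {s' // s' ∈ p.s.coverings},
      (Finsupp.single ⟨p.t, s', p.prop.covering (mem_coverings.1 s'.2)⟩ 1 : Vt K α) ⊗ₜ[K]
        (Finsupp.single
          ⟨p.t.contract s', p.s.contract s', p.prop.contract (mem_coverings.1 s'.2)⟩ 1 :
            V K α) := by
  simp [phi]

lemma xi_single (a b : SubforestPair α) (d : PruningPair α) :
    xi K α ((Finsupp.single a 1 ⊗ₜ[K] Finsupp.single b 1) ⊗ₜ[K] Finsupp.single d 1) =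
      xiBasis K a b d := by
  simp [xi]

/-- `xiBasis` prunes at a cut obtained by choice; as the cut is unique, any matching cut may replace
it. -/
lemma xiBasis_eq {a b : SubforestPair α} {d : PruningPair α} {ct : Finset α}
    (h : XiMatch a b d ct) : xiBasis K a b d =
      (Finsupp.single ⟨a.t, a.s.union b.s, a.prop.1, h.isSub⟩ 1 : Vt K α) ⊗ₜ[K]
        (Finsupp.single ⟨a.t.contract (a.s.union b.s),
          (a.t.contract (a.s.union b.s)).prune ct, h.isPruningPair⟩ 1 : V K α) := by
  have hex : ∃ ct, XiMatch a b d ct := ⟨ct, h⟩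
  have hct : hex.choose = ct := hex.choose_spec.unique h
  rw [xiBasis, dif_pos hex]
  congr 3
  rw [hct]

lemma xiTensorId_tau23_single {a b : SubforestPair α} {d : PruningPair α} {ct : Finset α}
    (h : XiMatch a b d ct) (d' : PruningPair α) :
    xiTensorId K α (tau23 K α ((Finsupp.single a 1 ⊗ₜ[K] Finsupp.single d 1) ⊗ₜ[K]
        (Finsupp.single b 1 ⊗ₜ[K] Finsupp.single d' 1))) =
      (Finsupp.single ⟨a.t, a.s.union b.s, a.prop.1, h.isSub⟩ 1 : Vt K α) ⊗ₜ[K]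
        ((Finsupp.single ⟨a.t.contract (a.s.union b.s),
          (a.t.contract (a.s.union b.s)).prune ct, h.isPruningPair⟩ 1 : V K α) ⊗ₜ[K]
            Finsupp.single d' 1) := by
  simp only [tau23, xiTensorId, LinearEquiv.coe_coe, LinearMap.comp_apply,
    TensorProduct.tensorTensorTensorComm_tmul, TensorProduct.assoc_symm_tmul,
    TensorProduct.map_tmul, LinearMap.id_apply]
  rw [xi_single, xiBasis_eq K h, TensorProduct.assoc_tmul]

/-- The cut at which a splitting is made satisfies the conditions of `ξ`. -/
lemma IsSplitting.xiMatch {t s a b : OGraph α} {c : Finset α} (h : IsSplitting t s c a b)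
    (ha : IsSubforestPair t a) (hb : IsSubforestPair (t.trunk c) b)
    (hd : IsPruningPair (t.contract a) ((s.prune c).contract a)) :
    XiMatch ⟨t, a, ha⟩ ⟨t.trunk c, b, hb⟩ ⟨t.contract a, (s.prune c).contract a, hd⟩ c := by
  have hc := h.pair.isAdm h.adm
  have he := h.pair.prune_eq h.adm.1
  refine ⟨⟨c, hc, rfl⟩, hc, h.not_meets_left, h.not_meets_right, rfl, ?_⟩
  change (s.prune c).contract a = _
  -- The pruning of `s` at `c` is that of `t`, and contracting `a` inside it commutes with pruning.
  rw [he, h.pair.1.prune_contract hc (he ▸ h.left.isSub)]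

end Maps

end TreeDoubling

/-! ### Matching the two sums -/

open TreeDoubling TreeDoubling.OGraph in
theorem mainTheorem1 (K : Type*) [Field K] (α : Type*) :
    TensorProduct.map LinearMap.id (TreeDoubling.delta K α) ∘ₗ TreeDoubling.phi K α =
      TreeDoubling.xiTensorId K α ∘ₗ TreeDoubling.tau23 K α ∘ₗ
        TensorProduct.map (TreeDoubling.phi K α) (TreeDoubling.phi K α) ∘ₗ
          TreeDoubling.delta K α := by
  refine Finsupp.lhom_ext' fun p => LinearMap.ext_ring ?_
  have hsplit : ∀ (x : Σ c : {c // c ∈ p.s.adm},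
      {a // a ∈ (p.s.prune c).coverings} × {b // b ∈ (p.s.trunk c).coverings}),
      IsSplitting p.t p.s x.1 x.2.1 x.2.2 := fun x =>
    ⟨p.prop, mem_adm.1 x.1.2, mem_coverings.1 x.2.1.2, mem_coverings.1 x.2.2.2⟩
  let e : (Σ c : {c // c ∈ p.s.adm},
      {a // a ∈ (p.s.prune c).coverings} × {b // b ∈ (p.s.trunk c).coverings}) →
      Σ s' : {s' // s' ∈ p.s.coverings}, {c // c ∈ (p.s.contract s').adm} := fun x =>
    ⟨⟨x.2.1.1.union x.2.2.1, mem_coverings.2 (hsplit x).union_isCovering⟩,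
      ⟨x.1.1, mem_adm.2 (hsplit x).isAdm_contract⟩⟩
  have he : Function.Bijective e := by
    constructor
    · rintro ⟨⟨c, hc⟩, ⟨a, ha⟩, ⟨b, hb⟩⟩ ⟨⟨c', hc'⟩, ⟨a', ha'⟩, ⟨b', hb'⟩⟩ h
      obtain rfl : c = c' := congrArg (fun x => x.2.1) h
      have hu : a.union b = a'.union b' := congrArg (fun x => x.1.1) h
      obtain ⟨rfl, rfl⟩ := (hsplit ⟨⟨c, hc⟩, ⟨a, ha⟩, ⟨b, hb⟩⟩).unique
        (hsplit ⟨⟨c, hc'⟩, ⟨a', ha'⟩, ⟨b', hb'⟩⟩) hu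
      rfl
    · rintro ⟨⟨s', hs'⟩, ⟨c, hc⟩⟩
      obtain ⟨a, b, h, rfl⟩ :=
        p.prop.exists_isSplitting (mem_coverings.1 hs') (mem_adm.1 hc)
      exact ⟨⟨⟨c, mem_adm.2 h.adm⟩, ⟨a, mem_coverings.2 h.left⟩, ⟨b, mem_coverings.2 h.right⟩⟩,
        rfl⟩
  -- The summand of the left side; reindexing along `e` turns the claim into an equality for each
  -- triple `(c, a, b)`.
  let T : (Σ s' : {s' // s' ∈ p.s.coverings}, {c // c ∈ (p.s.contract s').adm}) →
      Vt K α ⊗[K] (V K α ⊗[K] V K α) := fun y =>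
    have hs' := mem_coverings.1 y.1.2
    have hc := mem_adm.1 y.2.2
    (Finsupp.single ⟨p.t, y.1, p.prop.covering hs'⟩ 1 : Vt K α) ⊗ₜ[K]
      ((Finsupp.single ⟨p.t.contract y.1, (p.s.contract y.1).prune y.2,
        (p.prop.contract hs').prune hc⟩ 1 : V K α) ⊗ₜ[K]
          (Finsupp.single ⟨(p.t.contract y.1).trunk y.2, (p.s.contract y.1).trunk y.2,
            (p.prop.contract hs').trunk hc⟩ 1 : V K α))
  have hl : (TensorProduct.map LinearMap.id (delta K α) ∘ₗ phi K α) (Finsupp.single p 1) =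
      ∑ y : Σ s' : {s' // s' ∈ p.s.coverings}, {c // c ∈ (p.s.contract s').adm}, T y := by
    rw [Fintype.sum_sigma]
    simp only [LinearMap.comp_apply, phi_single, delta_single, map_sum,
      TensorProduct.map_tmul, LinearMap.id_apply, TensorProduct.tmul_sum, T]
  simp only [LinearMap.comp_apply] at hl ⊢
  refine hl.trans ?_
  rw [← he.sum_comp T, Fintype.sum_sigma, Finsupp.lsingle_apply, delta_single]
  simp only [map_sum, TensorProduct.map_tmul]
  refine Finset.sum_congr rfl fun c _ => ?_
  rw [Fintype.sum_prod_type, phi_single, phi_single, TensorProduct.sum_tmul]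
  simp only [TensorProduct.tmul_sum, map_sum]
  refine Finset.sum_congr rfl fun a _ => Finset.sum_congr rfl fun b _ => ?_
  have h := hsplit ⟨c, a, b⟩
  rw [xiTensorId_tau23_single K (h.xiMatch _ _ _)]
  simp only [T, e]
  -- The factor `(t, a ∪ b)` is literally the same on both sides; the prunings in the second factor
  -- and the trunks in the third remain to be compared.
  congr 3
  · congr 1
    exact h.prune_contract_union
  · congr 1
    · exact h.trunk_contract_tree
    · exact h.trunk_contract_forest
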